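/- Let $n \ge 0$, let $[n]=\{1,\dots,n\}$, and let $[n']=\{1',\dots,n'\}$ be a disjoint copy of $[n]$. Let $w$ be an $n\times n$ partial permutation matrix, i.e. a $0/1$ matrix with at most one $1$ in each row and each column, and let $S(w)=\{(i,j) : w_{ij}=1\}$. *Matrix Schubert ideal.* Let $B\subset GL_n(\mathbb{C})$ be the group of invertible upper triangular matrices, let $X_w=\overline{B^T w B}\subseteq\mathbb{C}^{n\times n}$ be the Zariski closure of $\{b^T w c : b,c\in B\}$, and let $I_w\subseteq\mathbb{C}[\sigma_{ij} : i\in[n],\, j\in[n']]$ be the vanishing ideal of $X_w$. *The DAG $G(w)$.* It has vertex set $[n]\cup[n']\cup S(w)$ and the edges $k\to l$ for $k<l$ in $[n]$; $k'\to l'$ for $k'<l'$ in $[n']$; and, for each $(i,j)\in S(w)$, $(i,j)\to k$ for all $k\in[n]$ with $k\ge i$ and $(i,j)\to k'$ for all $k'\in[n']$ with $k\ge j$. *Ideals of Gaussian Bayesian networks.* For a finite DAG $G$ with vertex set $V$, a trek from $u$ to $v$ is a simple path $P$ from $u$ to $v$ (edges may be traversed in either direction) containing no collider, i.e. no two distinct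 edges $i\to k$, $j\to k$ with the same head; it has a unique topmost vertex $\mathrm{top}(P)$. Let $T(u,v)$ be the set of treks from $u$ to $v$ ($T(u,u)$ consists of the empty trek). Let $\mathbb{C}[\sigma_{uv} : u,v\in V]$ be the polynomial ring with $\sigma_{uv}=\sigma_{vu}$, let $\mathbb{C}[a,\lambda]$ be the polynomial ring with one indeterminate $a_v$ for each vertex $v$ and one indeterminate $\lambda_{kl}$ for each edge $k\to l$, and let $$\phi_G:\mathbb{C}[\sigma_{uv} : u,v\in V]\to\mathbb{C}[a,\lambda],\qquad \sigma_{uv}\mapsto\sum_{P\in T(u,v)}a_{\mathrm{top}(P)}\prod_{k\to l\in P}\lambda_{kl}.$$ Put $I_G=\ker\phi_G$ and, for a set $O\subseteq V$ of observed vertices, $I_{G,O}=I_G\cap\mathbb{C}[\sigma_{uv} : u,v\in O]$. **Theorem.** With observed vertices $[n]\cup[n']$, $$I_w\cdot\mathbb{C}[\sigma_{ij} : i,j\in[n]\cup[n']]=I_{G(w),[n]\cup[n']}.$$ -/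

import Mathlib

noncomputable section

/-- A directed acyclic graph on the vertex set `V`. -/
structure DAG (V : Type*) extends Digraph V where
  acyclic : ∀ v, ¬ Relation.TransGen Adj v v

namespace DAG

variable {V : Type*} (G : DAG V)

theorem ne_of_adj {u v : V} (h : G.Adj u v) : u ≠ v := by
  rintro rfl
  exact G.acyclic u (.single h)

theorem asymm {u v : V} (h : G.Adj u v) : ¬ G.Adj v u :=
  fun h' => G.acyclic u (.tail (.single h) h')

/-- The underlying undirected graph of `G`. -/
def skeleton : SimpleGraph V where
  Adj u v := G.Adj u v ∨ G.Adj v u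
  symm := ⟨fun _ _ h => h.symm⟩
  loopless := ⟨fun _ h => h.elim (fun h => G.ne_of_adj h rfl) (fun h => G.ne_of_adj h rfl)⟩

/-- The set of directed edges `u → v` of `G`. -/
abbrev Edge : Type _ := {e : V × V // G.Adj e.1 e.2}

open Classical in
/-- The directed edge of `G` underlying a step of an undirected walk. -/
def arrow (d : G.skeleton.Dart) : G.Edge :=
  if h : G.Adj d.fst d.snd then ⟨(d.fst, d.snd), h⟩
  else ⟨(d.snd, d.fst), d.adj.resolve_left h⟩

/-- No two distinct edges `i → k` and `j → k` of the walk have the same head. -/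
def NoCollider {u v : V} (p : G.skeleton.Walk u v) : Prop :=
  ∀ i j k, i ≠ j → s(i, k) ∈ p.edges → s(j, k) ∈ p.edges → ¬ (G.Adj i k ∧ G.Adj j k)

/-- A trek from `i` to `j`: a simple path in `G` (whose edges may be traversed in either
direction) without a collider. -/
def Trek (i j : V) : Type _ := {p : G.skeleton.Walk i j // p.IsPath ∧ G.NoCollider p}

instance [Finite V] (i j : V) : Finite (G.Trek i j) := by
  classical
  have := Fintype.ofFinite V
  exact Finite.of_injective (β := G.skeleton.Path i j) (fun p => ⟨p.1, p.2.1⟩)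
    (fun _ _ h => Subtype.ext (congrArg (fun r : G.skeleton.Path i j => r.1) h))

instance [Finite V] (i j : V) : Fintype (G.Trek i j) := Fintype.ofFinite _

open Classical in
/-- The topmost vertex of a colliderless walk: go up against the arrows until the walk ends or
turns downwards. -/
def top {u : V} : {v : V} → G.skeleton.Walk u v → V
  | _, .nil => u
  | _, .cons (v := x) _ p => if G.Adj u x then u else top p

/-- The indeterminates of the parameter ring: `a_v` for the vertices (`Sum.inl v`) and `λ_{uv}`
for the directed edges (`Sum.inr ⟨(u, v), _⟩`). -/
abbrev Param : Type _ := V ⊕ G.Edge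

/-- `a_{top(P)} * ∏_{k → l ∈ P} λ_{kl}`. -/
def walkMonomial {u v : V} (p : G.skeleton.Walk u v) : MvPolynomial G.Param ℂ :=
  MvPolynomial.X (Sum.inl (G.top p)) *
    (p.darts.map fun d => MvPolynomial.X (Sum.inr (G.arrow d))).prod

/-- `∑_{P ∈ T(i,j)} a_{top(P)} * ∏_{k → l ∈ P} λ_{kl}`. -/
def trekSum [Finite V] (i j : V) : MvPolynomial G.Param ℂ :=
  ∑ P : G.Trek i j, G.walkMonomial P.1

/-! Reversal of treks, showing that the trek sum is symmetric in its two end points. -/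

theorem arrow_symm (d : G.skeleton.Dart) : G.arrow d.symm = G.arrow d := by
  unfold arrow
  rcases d.adj with h | h
  · have h' := G.asymm h
    simp [h, h']
  · have h' := G.asymm h
    simp [h, h']

variable {G}

theorem NoCollider.reverse {u v : V} {p : G.skeleton.Walk u v} (h : G.NoCollider p) :
    G.NoCollider p.reverse := by
  intro i j k hij h1 h2
  rw [SimpleGraph.Walk.edges_reverse, List.mem_reverse] at h1 h2
  exact h i j k hij h1 h2

theorem NoCollider.of_cons {u v w : V} {h : G.skeleton.Adj u v} {p : G.skeleton.Walk v w}
    (hp : G.NoCollider (.cons h p)) : G.NoCollider p := by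
  intro i j k hij h1 h2
  exact hp i j k hij (by simp [h1]) (by simp [h2])

theorem top_mem_support {u v : V} (p : G.skeleton.Walk u v) : G.top p ∈ p.support := by
  induction p with
  | nil => simp [top]
  | cons h p ih =>
    unfold top
    split_ifs
    · simp
    · simp [ih]

theorem exists_in_of_down {u v w : V} (h : G.skeleton.Adj u v) (p : G.skeleton.Walk v w)
    (hp : (SimpleGraph.Walk.cons h p).IsPath) (hc : G.NoCollider (.cons h p)) (huv : G.Adj u v) :
    ∀ x ∈ p.support, ∃ y, s(y, x) ∈ (SimpleGraph.Walk.cons h p).edges ∧ G.Adj y x := by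
  induction p generalizing u with
  | nil =>
    intro x hx
    simp only [SimpleGraph.Walk.support_nil, List.mem_singleton] at hx
    subst hx
    exact ⟨u, by simp, huv⟩
  | @cons a b c hab q ih =>
    intro x hx
    rw [SimpleGraph.Walk.support_cons, List.mem_cons] at hx
    rcases hx with rfl | hx
    · exact ⟨u, by simp, huv⟩
    · have hub : u ≠ b := by
        rintro rfl
        rw [SimpleGraph.Walk.cons_isPath_iff] at hp
        exact hp.2 (by simp)
      have hab' : G.Adj a b := by
        have hab2 : G.Adj a b ∨ G.Adj b a := hab
        rcases hab2 with h1 | h1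
        · exact h1
        · exact absurd ⟨huv, h1⟩ (hc u b a hub (by simp)
            (by simp [Sym2.eq_swap]))
      obtain ⟨y, hy, hyx⟩ := ih hab ((SimpleGraph.Walk.cons_isPath_iff _ _).1 hp).1
        hc.of_cons hab' x hx
      exact ⟨y, by rw [SimpleGraph.Walk.edges_cons]; exact List.mem_cons_of_mem _ hy, hyx⟩

/-- The top of a trek is its unique vertex that is not the head of an edge of the trek. -/
theorem eq_top_iff {u v : V} (p : G.skeleton.Walk u v) (hp : p.IsPath) (hc : G.NoCollider p)
    (x : V) : x = G.top p ↔ x ∈ p.support ∧ ∀ y, s(y, x) ∈ p.edges → ¬ G.Adj y x := by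
  induction p with
  | nil => simp [top]
  | @cons a b c hab q ih =>
    have hp' := (SimpleGraph.Walk.cons_isPath_iff _ _).1 hp
    unfold top
    split_ifs with h
    · constructor
      · rintro rfl
        refine ⟨by simp, fun y hy hyx => ?_⟩
        rw [SimpleGraph.Walk.edges_cons, List.mem_cons] at hy
        rcases hy with hy | hy
        · rw [Sym2.eq_iff] at hy
          rcases hy with ⟨h1, h2⟩ | ⟨h1, h2⟩
          · exact G.ne_of_adj h h2
          · subst h1
            exact G.asymm h hyx
        · exact hp'.2 (q.snd_mem_support_of_mem_edges hy)
      · rintro ⟨hx, hx'⟩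
        rw [SimpleGraph.Walk.support_cons, List.mem_cons] at hx
        rcases hx with rfl | hx
        · rfl
        · obtain ⟨y, hy, hyx⟩ := exists_in_of_down hab q hp hc h x hx
          exact absurd hyx (hx' y hy)
    · have hba : G.Adj b a := hab.resolve_left h
      rw [ih hp'.1 hc.of_cons]
      constructor
      · rintro ⟨hx, hx'⟩
        refine ⟨by simp [hx], fun y hy hyx => ?_⟩
        rw [SimpleGraph.Walk.edges_cons, List.mem_cons] at hy
        rcases hy with hy | hy
        · rw [Sym2.eq_iff] at hy
          rcases hy with ⟨h1, h2⟩ | ⟨h1, h2⟩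
          · subst h1 h2
            exact h hyx
          · subst h2
            exact hp'.2 hx
        · exact hx' y hy hyx
      · rintro ⟨hx, hx'⟩
        refine ⟨?_, fun y hy => hx' y (by simp [hy])⟩
        rw [SimpleGraph.Walk.support_cons, List.mem_cons] at hx
        rcases hx with rfl | hx
        · exact absurd hba (hx' b (by simp [Sym2.eq_swap]))
        · exact hx

theorem top_reverse {u v : V} (p : G.skeleton.Walk u v) (hp : p.IsPath) (hc : G.NoCollider p) :
    G.top p.reverse = G.top p := by
  have h := (eq_top_iff p.reverse hp.reverse hc.reverse (G.top p.reverse)).1 rfl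
  rw [eq_top_iff p hp hc]
  simpa using h

theorem walkMonomial_reverse {u v : V} (p : G.skeleton.Walk u v) (hp : p.IsPath)
    (hc : G.NoCollider p) : G.walkMonomial p.reverse = G.walkMonomial p := by
  unfold walkMonomial
  rw [top_reverse p hp hc, SimpleGraph.Walk.darts_reverse, List.map_reverse, List.prod_reverse,
    List.map_map]
  congr 3
  funext d
  simp [arrow_symm]

variable (G)

/-- Reversal of treks. -/
def trekReverse (i j : V) : G.Trek i j ≃ G.Trek j i where
  toFun P := ⟨P.1.reverse, P.2.1.reverse, P.2.2.reverse⟩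
  invFun P := ⟨P.1.reverse, P.2.1.reverse, P.2.2.reverse⟩
  left_inv P := Subtype.ext P.1.reverse_reverse
  right_inv P := Subtype.ext P.1.reverse_reverse

theorem trekSum_comm [Finite V] (i j : V) : G.trekSum i j = G.trekSum j i :=
  Fintype.sum_equiv (G.trekReverse i j) _ _
    fun P => (walkMonomial_reverse P.1 P.2.1 P.2.2).symm

/-- The trek rule homomorphism `φ_G : ℂ[σ_ij] → ℂ[a, λ]`. The indeterminates `σ_ij = σ_ji` are
indexed by unordered pairs of vertices. -/
def trekHom [Finite V] : MvPolynomial (Sym2 V) ℂ →ₐ[ℂ] MvPolynomial G.Param ℂ :=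
  MvPolynomial.aeval (Sym2.lift ⟨G.trekSum, G.trekSum_comm⟩)

/-- The ideal `I_G` of the Gaussian Bayesian network `G`. -/
def ideal [Finite V] : Ideal (MvPolynomial (Sym2 V) ℂ) := RingHom.ker G.trekHom

/-- The hidden variable ideal `I_{G,O} = I_G ∩ ℂ[σ_ij | i, j ∈ O]`, where the set `O` of observed
vertices is given by its inclusion `o` into `V`. -/
def hiddenIdeal [Finite V] {O : Type*} (o : O ↪ V) : Ideal (MvPolynomial (Sym2 O) ℂ) :=
  G.ideal.comap (MvPolynomial.rename (Sym2.map o))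

end DAG

section Schubert

variable {n : ℕ}

/-- A `0/1` matrix with at most one `1` in each row and each column. -/
def IsPartialPermutation (w : Matrix (Fin n) (Fin n) ℂ) : Prop :=
  (∀ i j, w i j = 0 ∨ w i j = 1) ∧
  (∀ i j j', w i j = 1 → w i j' = 1 → j = j') ∧
  (∀ i i' j, w i j = 1 → w i' j = 1 → i = i')

/-- `b` belongs to the Borel group of invertible upper triangular matrices. -/
def IsBorel (b : Matrix (Fin n) (Fin n) ℂ) : Prop :=
  IsUnit b ∧ b.BlockTriangular id

/-- The double orbit `Bᵀ w B`, as a set of points of the affine space with coordinates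
indexed by `[n] × [n']`. -/
def borelOrbit (w : Matrix (Fin n) (Fin n) ℂ) : Set (Fin n × Fin n → ℂ) :=
  {x | ∃ b c : Matrix (Fin n) (Fin n) ℂ, IsBorel b ∧ IsBorel c ∧ ∀ i j, x (i, j) = (b.transpose * w * c) i j}

/-- The matrix Schubert variety `X_w`: the Zariski closure of `Bᵀ w B`. -/
def matrixSchubertVariety (w : Matrix (Fin n) (Fin n) ℂ) : Set (Fin n × Fin n → ℂ) :=
  MvPolynomial.zeroLocus ℂ (MvPolynomial.vanishingIdeal ℂ (borelOrbit w))

/-- The vanishing ideal `I_w` of `X_w`. -/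
def schubertIdeal (w : Matrix (Fin n) (Fin n) ℂ) : Ideal (MvPolynomial (Fin n × Fin n) ℂ) :=
  MvPolynomial.vanishingIdeal ℂ (matrixSchubertVariety w)

/-- The positions `S(w)` of the ones of `w`. -/
abbrev Ones (w : Matrix (Fin n) (Fin n) ℂ) : Type := {s : Fin n × Fin n // w s.1 s.2 = 1}

/-- The observed vertices `[n] ∪ [n']`: `Sum.inl i` is `i` and `Sum.inr j` is `j'`. -/
abbrev Observed (n : ℕ) : Type := Fin n ⊕ Fin n

/-- The edges of `G(w)` on the vertex set `([n] ∪ [n']) ∪ S(w)`. -/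
inductive SchubertEdge (w : Matrix (Fin n) (Fin n) ℂ) :
    Observed n ⊕ Ones w → Observed n ⊕ Ones w → Prop
  | unprimed {k l : Fin n} : k < l → SchubertEdge w (.inl (.inl k)) (.inl (.inl l))
  | primed {k l : Fin n} : k < l → SchubertEdge w (.inl (.inr k)) (.inl (.inr l))
  | hiddenUnprimed {s : Ones w} {k : Fin n} :
      s.1.1 ≤ k → SchubertEdge w (.inr s) (.inl (.inl k))
  | hiddenPrimed {s : Ones w} {k : Fin n} :
      s.1.2 ≤ k → SchubertEdge w (.inr s) (.inl (.inr k))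

/-- A numbering of the vertices of `G(w)` that increases along all edges. -/
def schubertRank (w : Matrix (Fin n) (Fin n) ℂ) : Observed n ⊕ Ones w → ℕ
  | .inl (.inl k) => k + 1
  | .inl (.inr k) => k + 1
  | .inr _ => 0

theorem SchubertEdge.rank_lt {w : Matrix (Fin n) (Fin n) ℂ} {u v : Observed n ⊕ Ones w}
    (h : SchubertEdge w u v) : schubertRank w u < schubertRank w v := by
  cases h <;> simp_all [schubertRank]

/-- The directed acyclic graph `G(w)`. -/
def schubertDAG (w : Matrix (Fin n) (Fin n) ℂ) : DAG (Observed n ⊕ Ones w) where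
  Adj := SchubertEdge w
  acyclic v h := by
    have key : ∀ u, Relation.TransGen (SchubertEdge w) v u →
        schubertRank w v < schubertRank w u := by
      intro u hu
      induction hu with
      | single h => exact h.rank_lt
      | tail _ h ih => exact ih.trans h.rank_lt
    exact lt_irrefl _ (key v h)

/-- The inclusion `ℂ[σ_ij | i ∈ [n], j ∈ [n']] → ℂ[σ_ij | i, j ∈ [n] ∪ [n']]`. -/
def crossInclusion (n : ℕ) :
    MvPolynomial (Fin n × Fin n) ℂ →ₐ[ℂ] MvPolynomial (Sym2 (Observed n)) ℂ :=
  MvPolynomial.rename fun p => s(Sum.inl p.1, Sum.inr p.2)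

end Schubert

end

/-! ### Trek sums, their recursion and the covariance map. -/

namespace DAG

variable {V : Type*} {G : DAG V}

/-! Since ℂ is infinite, `hiddenIdeal` consists of the polynomials vanishing at every observed
covariance matrix (`mem_hiddenIdeal_iff`). Cutting off the first edge of a trek gives the structural
recursion `covariance_eq_sum`: the covariance of `j` with a different vertex `i` of which `j` is no
ancestor is a weighted sum over the parents of `j`.

For `G(w)` this makes the block between the two chains factor through the hidden vertices
(`covariance_cross`). The vector of covariances with `s = (p, q)` is supported on indices `≥ p` in
the first chain and `≥ q` in the second. With these vectors as rows `p` of `b` and `q` of `c`, the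
cross block is `bᵀ w c` with `b`, `c` upper triangular. They may be singular, but `b + t`, `c + t`
are invertible for almost all `t`, so every element of `I_w` vanishes there. This is one inclusion.

Conversely, take any point whose cross block is `bᵀ w c` in the orbit. Prescribe the rows of `b` and
`c` as covariances with the hidden vertices and give these variance one. The edge weights then come
from linear systems, solvable if certain minors are nonzero (`exists_param`). Adding `t` to the
diagonal entries keeps the cross block and makes these minors nonzero for almost all `t`, so a
polynomial in the hidden ideal vanishes at the point itself (`eval_eq_zero_of_eventually`). It
therefore vanishes on the whole cylinder over the orbit, and `mem_map_vanishingIdeal` puts it in the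
extension of `I_w`. -/

/-- Once a colliderless path points down it can never turn up again, so all its later vertices are
ancestors of its end. -/
theorem reflTransGen_of_down {u v w : V} (h : G.skeleton.Adj u v) (p : G.skeleton.Walk v w)
    (hp : (SimpleGraph.Walk.cons h p).IsPath) (hc : G.NoCollider (.cons h p)) (huv : G.Adj u v) :
    ∀ x ∈ p.support, Relation.ReflTransGen G.Adj x w := by
  induction p generalizing u with
  | nil =>
    intro x hx
    simp only [SimpleGraph.Walk.support_nil, List.mem_singleton] at hx
    exact hx ▸ .refl
  | @cons a b c hab q ih =>
    have hub : u ≠ b := by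
      rintro rfl
      rw [SimpleGraph.Walk.cons_isPath_iff] at hp
      exact hp.2 (by simp)
    have hab' : G.Adj a b := by
      refine Or.resolve_right hab fun h1 => ?_
      exact hc u b a hub (by simp) (by simp [Sym2.eq_swap]) ⟨huv, h1⟩
    have key := ih hab ((SimpleGraph.Walk.cons_isPath_iff _ _).1 hp).1 hc.of_cons hab'
    intro x hx
    rw [SimpleGraph.Walk.support_cons, List.mem_cons] at hx
    rcases hx with rfl | hx
    · exact .head hab' (key b q.start_mem_support)
    · exact key x hx

/-- Every vertex of a trek is an ancestor of one of the end points. -/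
theorem reflTransGen_of_mem_support {u v : V} (p : G.skeleton.Walk u v) (hp : p.IsPath)
    (hc : G.NoCollider p) :
    ∀ x ∈ p.support, Relation.ReflTransGen G.Adj x u ∨ Relation.ReflTransGen G.Adj x v := by
  induction p with
  | nil =>
    intro x hx
    simp only [SimpleGraph.Walk.support_nil, List.mem_singleton] at hx
    exact .inl (hx ▸ .refl)
  | @cons a b c hab q ih =>
    intro x hx
    rw [SimpleGraph.Walk.support_cons, List.mem_cons] at hx
    rcases hx with rfl | hx
    · exact .inl .refl
    · have hab2 : G.Adj a b ∨ G.Adj b a := hab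
      rcases hab2 with h | h
      · exact .inr (reflTransGen_of_down hab q hp hc h x hx)
      · exact (ih ((SimpleGraph.Walk.cons_isPath_iff _ _).1 hp).1 hc.of_cons x hx).imp_left
          fun hxb => hxb.tail h

theorem skeleton_adj_of_adj {u v : V} (h : G.Adj v u) : G.skeleton.Adj u v := Or.inr h

/-- A trek starting at a parent `k` of `j`, extended by the edge `k → j`. -/
def Trek.consParent {i j k : V} (hji : j ≠ i) (hanc : ¬ Relation.TransGen G.Adj j i)
    (hkj : G.Adj k j) (P : G.Trek k i) : G.Trek j i :=
  -- A vertex of `P` is an ancestor of `k` or of `i`: the first would close a cycle through `k → j`,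
  -- the second is excluded by `hanc`.
  have hj : j ∉ P.1.support := fun hj =>
    (reflTransGen_of_mem_support P.1 P.2.1 P.2.2 j hj).elim
      (fun h => G.acyclic j (.tail' h hkj))
      (fun h => hanc ((Relation.reflTransGen_iff_eq_or_transGen.1 h).resolve_left (Ne.symm hji)))
  ⟨.cons (skeleton_adj_of_adj hkj) P.1, (SimpleGraph.Walk.cons_isPath_iff _ _).2 ⟨P.2.1, hj⟩, by
    intro x y z hxy hx hy hadj
    rw [SimpleGraph.Walk.edges_cons, List.mem_cons] at hx hy
    have new : ∀ x y : V, s(x, z) = s(j, k) → s(y, z) ∈ P.1.edges → G.Adj x z → False := by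
      intro x y h1 h2 h3
      rw [Sym2.eq_iff] at h1
      rcases h1 with ⟨rfl, rfl⟩ | ⟨rfl, rfl⟩
      · exact G.asymm h3 hkj
      · exact hj (P.1.snd_mem_support_of_mem_edges h2)
    rcases hx with hx | hx <;> rcases hy with hy | hy
    · exact hxy (Sym2.congr_left.1 (hx.trans hy.symm))
    · exact new x y hx hy hadj.1
    · exact new y x hy hx hadj.2
    · exact P.2.2 x y z hxy hx hy hadj⟩

theorem walkMonomial_cons_parent {i j k : V} (hkj : G.Adj k j) (p : G.skeleton.Walk k i) :
    G.walkMonomial (.cons (skeleton_adj_of_adj hkj) p) =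
      MvPolynomial.X (Sum.inr ⟨(k, j), hkj⟩) * G.walkMonomial p := by
  have h := G.asymm hkj
  simp only [walkMonomial, top, h, if_false, SimpleGraph.Walk.darts_cons, List.map_cons,
    List.prod_cons, arrow, dif_neg, not_false_eq_true]
  ring

/-- A trek from `j` starting with a downward edge would make `j` an ancestor of `i`, so its first
edge comes from a parent of `j`. -/
theorem bijective_consParent {i j : V} (hji : j ≠ i) (hanc : ¬ Relation.TransGen G.Adj j i) :
    Function.Bijective fun P : Σ k : {k // G.Adj k j}, G.Trek k.1 i =>
      P.2.consParent hji hanc P.1.2 := by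
  constructor
  · rintro ⟨⟨k, hk⟩, P⟩ ⟨⟨l, hl⟩, Q⟩ h
    have h' := congrArg Subtype.val h
    simp only [Trek.consParent, SimpleGraph.Walk.cons.injEq] at h'
    obtain ⟨rfl, h'⟩ := h'
    have hPQ : P = Q := Subtype.ext (eq_of_heq h')
    rw [hPQ]
  · rintro ⟨p, hp, hc⟩
    cases p with
    | nil => exact absurd rfl hji
    | @cons _ k _ h q =>
      have hkj : G.Adj k j := by
        refine Or.resolve_left h fun h1 => hanc ?_
        exact .head' h1 (reflTransGen_of_down h q hp hc h1 k q.start_mem_support)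
      exact ⟨⟨⟨k, hkj⟩, q, ((SimpleGraph.Walk.cons_isPath_iff _ _).1 hp).1, hc.of_cons⟩, rfl⟩

variable (G)

theorem trekSum_self [Finite V] (i : V) : G.trekSum i i = MvPolynomial.X (Sum.inl i) := by
  let e : G.Trek i i := ⟨.nil, .nil, fun _ _ _ _ h => by simp at h⟩
  have he : ∀ P : G.Trek i i, P = e := fun P =>
    Subtype.ext (SimpleGraph.Walk.eq_nil_iff_nil.2 (SimpleGraph.Walk.isPath_iff_nil.1 P.2.1))
  rw [trekSum, Fintype.sum_eq_single e fun P hP => absurd (he P) hP]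
  simp [e, walkMonomial, top]

/-- The trek sum, decomposed according to the first edge of the treks. -/
theorem trekSum_eq_sum [Finite V] {i j : V} [Fintype {k // G.Adj k j}] (hji : j ≠ i)
    (hanc : ¬ Relation.TransGen G.Adj j i) :
    G.trekSum j i = ∑ k : {k // G.Adj k j},
      MvPolynomial.X (Sum.inr ⟨(k.1, j), k.2⟩) * G.trekSum k.1 i := by
  have h := (bijective_consParent hji hanc).sum_comp fun P => G.walkMonomial P.1
  rw [trekSum, ← h, Fintype.sum_sigma]
  refine Finset.sum_congr rfl fun k _ => ?_
  rw [trekSum, Finset.mul_sum]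
  exact Finset.sum_congr rfl fun P _ => walkMonomial_cons_parent k.2 P.1

/-- The value of the trek sum at a point of the parameter space. -/
noncomputable def covariance [Finite V] (θ : G.Param → ℂ) (u v : V) : ℂ :=
  MvPolynomial.eval θ (G.trekSum u v)

open Classical in
/-- The weight of the edge `u → v`, which is zero if there is no such edge. -/
noncomputable def weight (θ : G.Param → ℂ) (u v : V) : ℂ :=
  if h : G.Adj u v then θ (Sum.inr ⟨(u, v), h⟩) else 0

theorem covariance_comm [Finite V] (θ : G.Param → ℂ) (u v : V) :
    G.covariance θ u v = G.covariance θ v u := by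
  rw [covariance, trekSum_comm, covariance]

theorem covariance_self [Finite V] (θ : G.Param → ℂ) (v : V) :
    G.covariance θ v v = θ (Sum.inl v) := by
  simp [covariance, trekSum_self]

theorem covariance_eq_sum [Fintype V] (θ : G.Param → ℂ) {i j : V} (hji : j ≠ i)
    (hanc : ¬ Relation.TransGen G.Adj j i) :
    G.covariance θ j i = ∑ k, G.weight θ k j * G.covariance θ k i := by
  classical
  have h0 : ∑ k, G.weight θ k j * G.covariance θ k i =
      ∑ k ∈ Finset.univ.filter (fun k => G.Adj k j), G.weight θ k j * G.covariance θ k i := by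
    refine (Finset.sum_subset (Finset.subset_univ _) fun k _ hk => ?_).symm
    have : ¬ G.Adj k j := by simpa using hk
    simp [weight, this]
  rw [h0, Finset.sum_subtype (p := fun k => G.Adj k j) _ (by simp), covariance,
    G.trekSum_eq_sum hji hanc, map_sum]
  refine Finset.sum_congr rfl fun k _ => ?_
  simp [weight, k.2, covariance]

theorem eval_trekHom [Finite V] (θ : G.Param → ℂ) (f : MvPolynomial (Sym2 V) ℂ) :
    MvPolynomial.eval θ (G.trekHom f) =
      MvPolynomial.eval (Sym2.lift ⟨G.covariance θ, G.covariance_comm θ⟩) f := by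
  induction f using MvPolynomial.induction_on with
  | C a => simp [trekHom]
  | add p q hp hq => simp [hp, hq]
  | mul_X p e h =>
    rw [map_mul, map_mul, map_mul, h]
    congr 1
    induction e using Sym2.ind
    simp [trekHom, covariance]

/-- Over the infinite field ℂ a polynomial in the parameters is zero as soon as all its values are,
which turns ideal membership into a statement about points. -/
theorem mem_hiddenIdeal_iff [Finite V] {O : Type*} (o : O ↪ V) (f : MvPolynomial (Sym2 O) ℂ) :
    f ∈ G.hiddenIdeal o ↔ ∀ θ : G.Param → ℂ, MvPolynomial.eval (Sym2.lift
      ⟨fun u v => G.covariance θ (o u) (o v), fun _ _ => G.covariance_comm θ _ _⟩) f = 0 := by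
  have key : ∀ θ : G.Param → ℂ, MvPolynomial.eval θ
      (G.trekHom (MvPolynomial.rename (Sym2.map o) f)) = MvPolynomial.eval (Sym2.lift
      ⟨fun u v => G.covariance θ (o u) (o v), fun _ _ => G.covariance_comm θ _ _⟩) f := by
    intro θ
    rw [eval_trekHom, MvPolynomial.eval_rename]
    congr 2
    funext e
    induction e using Sym2.ind
    simp
  simp only [← key]
  rw [hiddenIdeal, Ideal.mem_comap, ideal, RingHom.mem_ker]
  exact ⟨fun h θ => by rw [h, map_zero], fun h => MvPolynomial.funext fun θ => by rw [h, map_zero]⟩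

end DAG

/-! ### Cylinders and one-parameter perturbations. -/

namespace MvPolynomial

variable {α β : Type*}

/-- A polynomial that vanishes on the cylinder over a set `S` lies in the extension of the
vanishing ideal of `S`. -/
theorem mem_map_vanishingIdeal {ι : α → β} (hι : Function.Injective ι) (S : Set (α → ℂ))
    (f : MvPolynomial β ℂ) (hf : ∀ z : β → ℂ, z ∘ ι ∈ S → eval z f = 0) :
    f ∈ (vanishingIdeal ℂ S).map (rename ι : MvPolynomial α ℂ →ₐ[ℂ] MvPolynomial β ℂ) := by
  classical
  let e : ↥(Set.range ι)ᶜ ⊕ α ≃ β :=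
    (Equiv.sumComm _ _).trans (((Equiv.ofInjective ι hι).sumCongr (Equiv.refl _)).trans
      (Equiv.Set.sumCompl (Set.range ι)))
  have he : ∀ a, e (Sum.inr a) = ι a := fun a => by simp [e]
  -- View `f` as a polynomial in the variables outside the range of `ι`, with coefficients in the
  -- remaining ones.
  let Φ : MvPolynomial β ℂ ≃ₐ[ℂ] MvPolynomial ↥(Set.range ι)ᶜ (MvPolynomial α ℂ) :=
    (renameEquiv ℂ e.symm).trans (sumAlgEquiv ℂ _ _)
  have hΦC : ∀ g : MvPolynomial α ℂ, Φ.symm (C g) = rename ι g := by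
    intro g
    rw [AlgEquiv.symm_apply_eq]
    induction g using MvPolynomial.induction_on with
    | C a =>
      simp only [algHom_C, algebraMap_eq, Φ, AlgEquiv.trans_apply, renameEquiv_apply]
      exact (sumAlgEquiv_C_inl ..).symm
    | add p q hp hq => rw [map_add, hp, hq, map_add, map_add]
    | mul_X p i h =>
      rw [map_mul, h, map_mul, map_mul]
      congr 1
      simp only [rename_X, Φ, AlgEquiv.trans_apply, renameEquiv_apply, ← he,
        Equiv.symm_apply_apply]
      exact (sumAlgEquiv_X_inr ..).symm
  have heval : ∀ (x : α → ℂ) (y : ↥(Set.range ι)ᶜ → ℂ) (g : MvPolynomial β ℂ),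
      eval y (map (eval x) (Φ g)) = eval (Sum.elim y x ∘ e.symm) g := by
    intro x y g
    induction g using MvPolynomial.induction_on with
    | C a =>
      simp only [Φ, AlgEquiv.trans_apply, renameEquiv_apply, algHom_C, algebraMap_eq,
        sumAlgEquiv_C_inl, map_C, eval_C]
    | add p q hp hq => simp only [map_add, hp, hq]
    | mul_X p i h =>
      simp only [map_mul, h]
      congr 1
      simp only [rename_X, Φ, AlgEquiv.trans_apply, renameEquiv_apply]
      rcases hi : e.symm i with a | a <;> simp [sumAlgEquiv_X_inl, sumAlgEquiv_X_inr, hi]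
  -- Membership in an ideal extended along `C` is checked on coefficients. At a fixed `x ∈ S` the
  -- specialized polynomial vanishes for all `y`, so each coefficient vanishes at `x`.
  have hcoeff : Φ f ∈ (vanishingIdeal ℂ S).map
      (C : MvPolynomial α ℂ →+* MvPolynomial ↥(Set.range ι)ᶜ (MvPolynomial α ℂ)) := by
    rw [mem_map_C_iff]
    intro m x hx
    have h0 : map (eval x) (Φ f) = 0 := by
      refine MvPolynomial.funext fun y => ?_
      rw [heval, map_zero]
      refine hf _ ?_
      have : (Sum.elim y x ∘ e.symm) ∘ ι = x := by
        funext a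
        simp [← he]
      rwa [this]
    have := congrArg (coeff m) h0
    rw [coeff_map, coeff_zero] at this
    simpa [aeval_eq_eval] using this
  have hle : (vanishingIdeal ℂ S).map
      (C : MvPolynomial α ℂ →+* MvPolynomial ↥(Set.range ι)ᶜ (MvPolynomial α ℂ)) ≤
      ((vanishingIdeal ℂ S).map (rename ι : MvPolynomial α ℂ →ₐ[ℂ] MvPolynomial β ℂ)).comap
        Φ.symm := by
    rw [Ideal.map_le_iff_le_comap]
    intro g hg
    rw [Ideal.mem_comap, Ideal.mem_comap, hΦC]
    exact Ideal.mem_map_of_mem _ hg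
  simpa using hle hcoeff

/-- A polynomial that vanishes at all but finitely many points of a line vanishes on the line. -/
theorem eval_eq_zero_of_eventually {σ : Type*} (f : MvPolynomial σ ℂ) (z : σ → Polynomial ℂ)
    (s : Set ℂ) (hs : s.Finite)
    (h : ∀ t ∉ s, eval (fun i => (z i).eval t) f = 0) : eval (fun i => (z i).eval 0) f = 0 := by
  have key : ∀ t, (aeval z f).eval t = eval (fun i => (z i).eval t) f := by
    intro t
    clear h
    induction f using MvPolynomial.induction_on with
    | C a => simp
    | add p q hp hq => simp [hp, hq]
    | mul_X p i hp => simp [hp]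
  have h0 : aeval z f = 0 := Polynomial.eq_zero_of_infinite_isRoot _
    (hs.infinite_compl.mono fun t ht => (key t).trans (h t ht))
  rw [← key, h0, Polynomial.eval_zero]

end MvPolynomial

/-- The determinant is the monic characteristic polynomial of `-A` at `t`. -/
theorem Matrix.finite_setOf_det_add_smul_one_eq_zero {m : Type*} [Fintype m] [DecidableEq m]
    (A : Matrix m m ℂ) : {t : ℂ | (A + t • (1 : Matrix m m ℂ)).det = 0}.Finite := by
  refine (Polynomial.finite_setOfPred_isRoot (Matrix.charpoly_monic (-A)).ne_zero).subset ?_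
  intro t ht
  have : (A + t • (1 : Matrix m m ℂ)) = Matrix.scalar m t - (-A) := by
    ext i j
    simp [Matrix.scalar, Matrix.one_apply, Matrix.diagonal_apply, add_comm]
  rw [Set.mem_ofPred_eq, this, ← Matrix.eval_charpoly] at ht
  exact ht

/-! ### Covariances of `G(w)` and their realization by parameters. -/

section Schubert

variable {n : ℕ} {w : Matrix (Fin n) (Fin n) ℂ}

/-- The observed vertex `k` (for `false`) or `k'` (for `true`). -/
def observed : Bool → Fin n → Observed n
  | false, k => .inl k
  | true, k => .inr k

/-- The row (for `false`) or the column (for `true`) of a one of `w`. -/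
def onesCoord : Bool → Ones w → Fin n
  | false, s => s.1.1
  | true, s => s.1.2

theorem observed_surjective (x : Observed n) : ∃ b k, x = observed b k := by
  rcases x with k | k
  exacts [⟨false, k, rfl⟩, ⟨true, k, rfl⟩]

theorem observed_injective (b : Bool) : Function.Injective (observed (n := n) b) := by
  cases b
  exacts [Sum.inl_injective, Sum.inr_injective]

theorem observed_ne {b c : Bool} (h : b ≠ c) (k l : Fin n) : observed b k ≠ observed c l := by
  cases b <;> cases c <;> simp_all [observed]

theorem schubertDAG_adj_observed {b : Bool} {j : Fin n} {x : Observed n ⊕ Ones w} :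
    (schubertDAG w).Adj x (.inl (observed b j)) ↔
      (∃ k, k < j ∧ x = .inl (observed b k)) ∨ ∃ s, onesCoord b s ≤ j ∧ x = .inr s := by
  constructor
  · intro h
    cases b <;> rcases h with h | h | h | h
    exacts [.inl ⟨_, h, rfl⟩, .inr ⟨_, h, rfl⟩, .inl ⟨_, h, rfl⟩, .inr ⟨_, h, rfl⟩]
  · rintro (⟨k, hk, rfl⟩ | ⟨s, hs, rfl⟩) <;> cases b
    exacts [.unprimed hk, .primed hk, .hiddenUnprimed hs, .hiddenPrimed hs]

theorem schubertDAG_not_adj_hidden (x : Observed n ⊕ Ones w) (s : Ones w) :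
    ¬ (schubertDAG w).Adj x (.inr s) := by
  intro h
  cases h

theorem schubertDAG_transGen_observed {b : Bool} {j : Fin n} {v : Observed n ⊕ Ones w}
    (h : Relation.TransGen (schubertDAG w).Adj (.inl (observed b j)) v) :
    ∃ l, j < l ∧ v = .inl (observed b l) := by
  have step : ∀ (k : Fin n) (v : Observed n ⊕ Ones w),
      (schubertDAG w).Adj (.inl (observed b k)) v → ∃ l, k < l ∧ v = .inl (observed b l) := by
    intro k v h
    cases b <;> rcases h with h | h
    exacts [⟨_, h, rfl⟩, ⟨_, h, rfl⟩]
  induction h with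
  | single h => exact step _ _ h
  | tail _ h ih =>
    obtain ⟨l, hl, rfl⟩ := ih
    obtain ⟨m, hm, rfl⟩ := step _ _ h
    exact ⟨m, hl.trans hm, rfl⟩

variable (θ : (schubertDAG w).Param → ℂ)

theorem weight_observed_eq_zero {b : Bool} {k j : Fin n} (h : j ≤ k) :
    (schubertDAG w).weight θ (.inl (observed b k)) (.inl (observed b j)) = 0 := by
  rw [DAG.weight, dif_neg]
  rw [schubertDAG_adj_observed]
  rintro (⟨l, hl, h'⟩ | ⟨s, -, h'⟩)
  · exact absurd (observed_injective b (Sum.inl_injective h')) (by rintro rfl; exact hl.not_ge h)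
  · cases h'

theorem weight_hidden_eq_zero {b : Bool} {s : Ones w} {j : Fin n} (h : j < onesCoord b s) :
    (schubertDAG w).weight θ (.inr s) (.inl (observed b j)) = 0 := by
  rw [DAG.weight, dif_neg]
  rw [schubertDAG_adj_observed]
  rintro (⟨l, -, h'⟩ | ⟨s', hs', h'⟩)
  · cases h'
  · cases h'
    exact hs'.not_gt h

variable [Fintype (Ones w)]

/-- Hidden vertices are sources, so the recursion has no terms. -/
theorem covariance_hidden_of_ne {s s' : Ones w} (h : s ≠ s') :
    (schubertDAG w).covariance θ (.inr s) (.inr s') = 0 := by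
  rw [DAG.covariance_eq_sum]
  · refine Finset.sum_eq_zero fun k _ => ?_
    rw [DAG.weight, dif_neg (schubertDAG_not_adj_hidden k s), zero_mul]
  · simpa using h
  · intro h
    obtain ⟨x, -, hx⟩ := Relation.TransGen.tail'_iff.1 h
    exact schubertDAG_not_adj_hidden _ _ hx

/-- The recursion for the covariances along one of the two chains of observed vertices. -/
theorem covariance_observed (b : Bool) (j : Fin n) (v : Observed n ⊕ Ones w)
    (hv : ∀ l, v = .inl (observed b l) → l < j) :
    (schubertDAG w).covariance θ (.inl (observed b j)) v =
      ∑ k, (schubertDAG w).weight θ (.inl (observed b k)) (.inl (observed b j)) *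
        (schubertDAG w).covariance θ (.inl (observed b k)) v +
      ∑ s : Ones w, (schubertDAG w).weight θ (.inr s) (.inl (observed b j)) *
        (schubertDAG w).covariance θ (.inr s) v := by
  rw [DAG.covariance_eq_sum, Fintype.sum_sum_type, Fintype.sum_sum_type]
  · congr 1
    have hz : ∀ c, c ≠ b → ∀ k : Fin n,
        (schubertDAG w).weight θ (.inl (observed c k)) (.inl (observed b j)) = 0 := by
      intro c hc k
      rw [DAG.weight, dif_neg]
      rw [schubertDAG_adj_observed]
      rintro (⟨l, -, h'⟩ | ⟨s', -, h'⟩)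
      · exact observed_ne hc _ _ (Sum.inl_injective h')
      · cases h'
    cases b
    · have := hz true (by simp)
      simp only [observed] at this ⊢
      simp [this]
    · have := hz false (by simp)
      simp only [observed] at this ⊢
      simp [this]
  · rintro rfl
    exact lt_irrefl _ (hv j rfl)
  · intro h
    obtain ⟨l, hl, rfl⟩ := schubertDAG_transGen_observed h
    exact lt_asymm hl (hv l rfl)

theorem covariance_observed_hidden (b : Bool) (j : Fin n) (s : Ones w) :
    (schubertDAG w).covariance θ (.inl (observed b j)) (.inr s) =
      ∑ k, (schubertDAG w).weight θ (.inl (observed b k)) (.inl (observed b j)) *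
        (schubertDAG w).covariance θ (.inl (observed b k)) (.inr s) +
      (schubertDAG w).weight θ (.inr s) (.inl (observed b j)) * θ (.inl (.inr s)) := by
  rw [covariance_observed θ b j _ (by simp)]
  congr 1
  rw [Fintype.sum_eq_single s fun s' hs' => by rw [covariance_hidden_of_ne θ hs', mul_zero],
    DAG.covariance_self]

theorem covariance_observed_hidden_eq_zero (b : Bool) (s : Ones w) (j : Fin n)
    (h : j < onesCoord b s) :
    (schubertDAG w).covariance θ (.inl (observed b j)) (.inr s) = 0 := by
  induction j using WellFoundedLT.induction with
  | ind j ih =>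
    rw [covariance_observed_hidden, weight_hidden_eq_zero θ h, zero_mul, add_zero]
    refine Finset.sum_eq_zero fun k _ => ?_
    rcases lt_or_ge k j with hk | hk
    · rw [ih k hk (hk.trans h), mul_zero]
    · rw [weight_observed_eq_zero θ hk, zero_mul]

/-- The parameters with the same edge weights and with all vertex parameters equal to one. -/
noncomputable def normalizeParam : (schubertDAG w).Param → ℂ :=
  Sum.elim (fun _ => 1) fun e => θ (.inr e)

/-- Both sides satisfy the same linear recursion, whose inhomogeneous term alone carries the factor
`a_s`. -/
theorem covariance_observed_hidden_eq_mul (b : Bool) (s : Ones w) (j : Fin n) :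
    (schubertDAG w).covariance θ (.inl (observed b j)) (.inr s) = θ (.inl (.inr s)) *
      (schubertDAG w).covariance (normalizeParam θ) (.inl (observed b j)) (.inr s) := by
  have hw : (schubertDAG w).weight (normalizeParam θ) = (schubertDAG w).weight θ := rfl
  induction j using WellFoundedLT.induction with
  | ind j ih =>
    rw [covariance_observed_hidden, covariance_observed_hidden, hw, mul_add, Finset.mul_sum]
    congr 1
    · refine Finset.sum_congr rfl fun k _ => ?_
      rcases lt_or_ge k j with hk | hk
      · rw [ih k hk]
        ring
      · rw [weight_observed_eq_zero θ hk]
        ring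
    · simp [normalizeParam, mul_comm]

/-- The covariance matrix between the two chains factors over the hidden vertices. -/
theorem covariance_cross (i j : Fin n) :
    (schubertDAG w).covariance θ (.inl (observed true j)) (.inl (observed false i)) =
      ∑ s : Ones w, (schubertDAG w).covariance θ (.inl (observed false i)) (.inr s) *
        (schubertDAG w).covariance (normalizeParam θ) (.inl (observed true j)) (.inr s) := by
  have hw : (schubertDAG w).weight (normalizeParam θ) = (schubertDAG w).weight θ := rfl
  induction j using WellFoundedLT.induction with
  | ind j ih =>
    rw [covariance_observed θ true j _ (by
      intro l hl
      exact absurd (Sum.inl_injective hl) (observed_ne (by simp) _ _))]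
    simp_rw [covariance_observed_hidden (normalizeParam θ) true j, hw, mul_add,
      Finset.sum_add_distrib, Finset.mul_sum]
    rw [Finset.sum_comm]
    congr 1
    · refine Finset.sum_congr rfl fun k _ => ?_
      rcases lt_or_ge k j with hk | hk
      · rw [ih k hk, Finset.mul_sum]
        exact Finset.sum_congr rfl fun s _ => by ring
      · simp [weight_observed_eq_zero θ hk]
    -- The normalized variance of `s` is one, so both sides reduce to the weight of `s → j'` times
    -- the covariance of `i` and `s`.
    · refine Finset.sum_congr rfl fun s _ => ?_
      rw [DAG.covariance_comm]
      simp [normalizeParam, mul_comm]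

/-- All covariance matrices of the observed vertices with prescribed cross part of the form
`∑ s, u s i * u' s j` arise from parameters of `G(w)`, as long as some minors do not vanish. -/
theorem exists_param (u : Bool → Ones w → Fin n → ℂ)
    (hu : ∀ b s j, j < onesCoord b s → u b s j = 0) (z : Sym2 (Observed n) → ℂ)
    (hcross : ∀ i j, z s(observed false i, observed true j) =
      ∑ s, u false s i * u true s j)
    (hdet : ∀ b (j : Fin n), (Matrix.of fun k l : {k // k < j} =>
      z s(observed b k.1, observed b l.1) - ∑ s, u b s k.1 * u b s l.1).det ≠ 0) :
    ∃ θ : (schubertDAG w).Param → ℂ, ∀ x y : Observed n,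
      (schubertDAG w).covariance θ (.inl x) (.inl y) = z s(x, y) := by
  -- Regression of `j` on its predecessors in the chain, after the contribution of the hidden
  -- vertices has been subtracted; the coefficients are the edge weights `lam`.
  have hsol : ∀ b (j : Fin n), ∃ x : Fin n → ℂ, (∀ k, j ≤ k → x k = 0) ∧ ∀ i, i < j →
      ∑ k, x k * (z s(observed b k, observed b i) - ∑ s, u b s k * u b s i) =
        z s(observed b j, observed b i) - ∑ s, u b s j * u b s i := by
    intro b j
    have hunit := (Matrix.isUnit_iff_isUnit_det _).2 (isUnit_iff_ne_zero.2 (hdet b j))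
    obtain ⟨x, hx⟩ := (Matrix.vecMul_surjective_iff_isUnit.2 hunit) fun i : {k // k < j} =>
      z s(observed b j, observed b i.1) - ∑ s, u b s j * u b s i.1
    refine ⟨fun k => if h : k < j then x ⟨k, h⟩ else 0, fun k hk => dif_neg hk.not_gt, ?_⟩
    intro i hi
    rw [← Finset.sum_subset (Finset.subset_univ (Finset.univ.filter fun k => k < j))
        (fun k _ hk => by
          have : ¬ k < j := by simpa using hk
          simp only [this, dif_neg, not_false_eq_true, zero_mul]),
      Finset.sum_subtype (p := fun k => k < j) _ (by simp)]
    exact (Finset.sum_congr rfl fun k _ => congrArg (· * _) (dif_pos k.2)).trans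
      (congrFun hx ⟨i, hi⟩)
  choose lam hlam0 hlam using fun b j => hsol b j
  -- Forced by the recursion if `s` has variance one and covariance `u b s j` with `j`.
  let mu : Bool → Ones w → Fin n → ℂ := fun b s j => u b s j - ∑ k, lam b j k * u b s k
  have hmu : ∀ b s j, j < onesCoord b s → mu b s j = 0 := by
    intro b s j hj
    simp only [mu]
    rw [hu b s j hj, Finset.sum_eq_zero, sub_zero]
    intro k _
    rcases lt_or_ge k j with hk | hk
    · rw [hu b s k (hk.trans hj), mul_zero]
    · rw [hlam0 b j k hk, zero_mul]
  let E : Observed n ⊕ Ones w → Observed n ⊕ Ones w → ℂ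
    | .inl (.inl k), .inl (.inl j) => lam false j k
    | .inl (.inr k), .inl (.inr j) => lam true j k
    | .inr s, .inl (.inl j) => mu false s j
    | .inr s, .inl (.inr j) => mu true s j
    | _, _ => 0
  let θ : (schubertDAG w).Param → ℂ :=
    Sum.elim (Sum.elim (fun x => z s(x, x)) fun _ => 1) fun e => E e.1.1 e.1.2
  have hw1 : ∀ b k j, (schubertDAG w).weight θ (.inl (observed b k)) (.inl (observed b j)) =
      lam b j k := by
    intro b k j
    rcases lt_or_ge k j with hk | hk
    · rw [DAG.weight, dif_pos (schubertDAG_adj_observed.2 (.inl ⟨k, hk, rfl⟩))]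
      cases b <;> rfl
    · rw [weight_observed_eq_zero θ hk, hlam0 b j k hk]
  have hw2 : ∀ b s j, (schubertDAG w).weight θ (.inr s) (.inl (observed b j)) = mu b s j := by
    intro b s j
    rcases lt_or_ge j (onesCoord b s) with hj | hj
    · rw [weight_hidden_eq_zero θ hj, hmu b s j hj]
    · rw [DAG.weight, dif_pos (schubertDAG_adj_observed.2 (.inr ⟨s, hj, rfl⟩))]
      cases b <;> rfl
  have hhid : ∀ b s j, (schubertDAG w).covariance θ (.inl (observed b j)) (.inr s) = u b s j := by
    intro b s j
    induction j using WellFoundedLT.induction with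
    | ind j ih =>
      rw [covariance_observed_hidden, hw2]
      have h1 : θ (.inl (.inr s)) = 1 := rfl
      have h2 : ∀ k ∈ Finset.univ,
          (schubertDAG w).weight θ (.inl (observed b k)) (.inl (observed b j)) *
          (schubertDAG w).covariance θ (.inl (observed b k)) (.inr s) =
          lam b j k * u b s k := by
        intro k _
        rw [hw1]
        rcases lt_or_ge k j with hk | hk
        · rw [ih k hk]
        · rw [hlam0 b j k hk, zero_mul, zero_mul]
      rw [Finset.sum_congr rfl h2, h1]
      simp only [mu]
      ring
  have hdiag : ∀ b j i, i < j → (schubertDAG w).covariance θ (.inl (observed b j))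
      (.inl (observed b i)) = z s(observed b j, observed b i) := by
    intro b j
    induction j using WellFoundedLT.induction with
    | ind j ih =>
      intro i hi
      have h1 : ∀ k ∈ Finset.univ,
          (schubertDAG w).weight θ (.inl (observed b k)) (.inl (observed b j)) *
          (schubertDAG w).covariance θ (.inl (observed b k)) (.inl (observed b i)) =
          lam b j k * z s(observed b k, observed b i) := by
        intro k _
        rw [hw1]
        rcases lt_or_ge k j with hk | hk
        · congr 1
          rcases lt_trichotomy k i with h | rfl | h
          · rw [DAG.covariance_comm, ih i hi k h, Sym2.eq_swap]
          · rw [DAG.covariance_self]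
            rfl
          · exact ih k hk i h
        · rw [hlam0 b j k hk, zero_mul, zero_mul]
      have h2 : ∀ s ∈ Finset.univ,
          (schubertDAG w).weight θ (.inr s) (.inl (observed b j)) *
          (schubertDAG w).covariance θ (.inr s) (.inl (observed b i)) =
          u b s j * u b s i - ∑ k, lam b j k * (u b s k * u b s i) := by
        intro s _
        rw [hw2, DAG.covariance_comm, hhid]
        simp only [mu]
        rw [sub_mul, Finset.sum_mul]
        simp only [mul_assoc]
      rw [covariance_observed θ b j _ (by
        intro l hl
        rwa [← observed_injective b (Sum.inl_injective hl)]), Finset.sum_congr rfl h1,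
        Finset.sum_congr rfl h2, Finset.sum_sub_distrib, Finset.sum_comm]
      -- The `u`-terms of the regression equation cancel those produced by `mu`.
      have h3 := hlam b j i hi
      simp_rw [mul_sub, Finset.sum_sub_distrib, Finset.mul_sum] at h3
      linear_combination h3
  have hcr : ∀ i j, (schubertDAG w).covariance θ (.inl (observed true j))
      (.inl (observed false i)) = z s(observed false i, observed true j) := by
    intro i j
    rw [covariance_cross, hcross]
    refine Finset.sum_congr rfl fun s _ => ?_
    have h := covariance_observed_hidden_eq_mul θ true s j
    have h1 : θ (.inl (.inr s)) = 1 := rfl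
    rw [h1, one_mul, hhid] at h
    rw [hhid, ← h]
  refine ⟨θ, fun x y => ?_⟩
  obtain ⟨b, j, rfl⟩ := observed_surjective x
  obtain ⟨c, i, rfl⟩ := observed_surjective y
  by_cases hbc : b = c
  · subst hbc
    rcases lt_trichotomy i j with h | rfl | h
    · exact hdiag b j i h
    · rw [DAG.covariance_self]
      rfl
    · rw [DAG.covariance_comm, hdiag b i j h, Sym2.eq_swap]
  · cases b <;> cases c
    · simp at hbc
    · rw [DAG.covariance_comm, hcr]
    · rw [hcr, Sym2.eq_swap]
    · simp at hbc

end Schubert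

/-! ### Points of the matrix Schubert variety and the two inclusions. -/

section Schubert

variable {n : ℕ} {w : Matrix (Fin n) (Fin n) ℂ}

theorem schubertIdeal_eq_vanishingIdeal (w : Matrix (Fin n) (Fin n) ℂ) :
    schubertIdeal w = MvPolynomial.vanishingIdeal ℂ (borelOrbit w) :=
  le_antisymm (MvPolynomial.vanishingIdeal_anti_mono (MvPolynomial.zeroLocus_vanishingIdeal_le _))
    (MvPolynomial.le_vanishingIdeal_zeroLocus _)

theorem transpose_mul_mul_apply [Fintype (Ones w)] (hw : IsPartialPermutation w)
    (b c : Matrix (Fin n) (Fin n) ℂ) (i j : Fin n) :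
    (b.transpose * w * c) i j = ∑ s : Ones w, b s.1.1 i * c s.1.2 j := by
  classical
  have h1 : (b.transpose * w * c) i j = ∑ p : Fin n × Fin n, b p.1 i * w p.1 p.2 * c p.2 j := by
    simp only [Matrix.mul_apply, Matrix.transpose_apply, Finset.sum_mul]
    rw [Finset.sum_comm, Fintype.sum_prod_type]
  rw [h1, ← Finset.sum_subset
    (Finset.subset_univ (Finset.univ.filter fun p : Fin n × Fin n => w p.1 p.2 = 1))
    (fun p _ hp => by
      have : w p.1 p.2 ≠ 1 := by simpa using hp
      rw [(hw.1 p.1 p.2).resolve_right this, mul_zero, zero_mul]),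
    Finset.sum_subtype (p := fun p : Fin n × Fin n => w p.1 p.2 = 1) _ (by simp)]
  exact Finset.sum_congr rfl fun s _ => by rw [s.2, mul_one]

/-- The vectors become rows of `b`, distinct because `p` is injective, and their support condition
is triangularity. All other rows are zero, so `b` need not be invertible. -/
theorem exists_blockTriangular [Fintype (Ones w)] (p : Ones w → Fin n)
    (hp : Function.Injective p) (u : Ones w → Fin n → ℂ) (hu : ∀ s j, j < p s → u s j = 0) :
    ∃ b : Matrix (Fin n) (Fin n) ℂ, b.BlockTriangular id ∧ ∀ s, b (p s) = u s := by
  refine ⟨fun k j => ∑ s, if p s = k then u s j else 0, ?_, ?_⟩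
  · intro k j hjk
    refine Finset.sum_eq_zero fun s _ => ?_
    split_ifs with h
    · exact hu s j (h ▸ hjk)
    · rfl
  · intro s
    funext j
    exact (Fintype.sum_eq_single s fun t ht => if_neg (hp.ne ht)).trans (if_pos rfl)

theorem onesCoord_injective (hw : IsPartialPermutation w) (b : Bool) :
    Function.Injective (onesCoord (w := w) b) := by
  rintro ⟨⟨i, j⟩, hs⟩ ⟨⟨i', j'⟩, ht⟩ h
  cases b
  · obtain rfl : i = i' := h
    obtain rfl := hw.2.1 i j j' hs ht
    rfl
  · obtain rfl : j = j' := h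
    obtain rfl := hw.2.2 i i' j hs ht
    rfl

theorem isBorel_add_smul_one {b : Matrix (Fin n) (Fin n) ℂ} (hb : b.BlockTriangular id) {t : ℂ}
    (ht : (b + t • (1 : Matrix (Fin n) (Fin n) ℂ)).det ≠ 0) :
    IsBorel (b + t • (1 : Matrix (Fin n) (Fin n) ℂ)) :=
  ⟨(Matrix.isUnit_iff_isUnit_det _).2 (isUnit_iff_ne_zero.2 ht),
    hb.add fun i j hij => by
      rw [Matrix.smul_apply, Matrix.blockTriangular_one hij, smul_zero]⟩

/-- The matrix Schubert variety contains `bᵀ w c` for all upper triangular matrices `b`, `c`. -/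
theorem eval_eq_zero_of_blockTriangular {g : MvPolynomial (Fin n × Fin n) ℂ}
    (hg : g ∈ MvPolynomial.vanishingIdeal ℂ (borelOrbit w)) {b c : Matrix (Fin n) (Fin n) ℂ}
    (hb : b.BlockTriangular id) (hc : c.BlockTriangular id) :
    MvPolynomial.eval (fun p => (b.transpose * w * c) p.1 p.2) g = 0 := by
  -- The entries of `(b + t)ᵀ w (c + t)` as polynomials in `t`.
  let z : Fin n × Fin n → Polynomial ℂ := fun p =>
    ∑ l, (∑ k, Polynomial.C (b k p.1) * Polynomial.C (w k l) +
      Polynomial.X * Polynomial.C (w p.1 l)) *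
      (Polynomial.C (c l p.2) + Polynomial.X * Polynomial.C ((1 : Matrix _ _ ℂ) l p.2))
  have hz : ∀ t p, (z p).eval t = ((b + t • (1 : Matrix (Fin n) (Fin n) ℂ)).transpose * w *
      (c + t • (1 : Matrix (Fin n) (Fin n) ℂ))) p.1 p.2 := by
    intro t p
    have h : (b + t • (1 : Matrix (Fin n) (Fin n) ℂ)).transpose * w = b.transpose * w + t • w := by
      simp [Matrix.transpose_add, Matrix.add_mul]
    rw [h, Matrix.mul_apply]
    simp [z, Polynomial.eval_finsetSum, Matrix.mul_apply, mul_comm t]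
  have h := MvPolynomial.eval_eq_zero_of_eventually g z _
    ((Matrix.finite_setOf_det_add_smul_one_eq_zero b).union
      (Matrix.finite_setOf_det_add_smul_one_eq_zero c)) (by
    intro t ht
    simp only [Set.mem_union, Set.mem_ofPred_eq, not_or] at ht
    have := hg (fun p => (z p).eval t) ⟨_, _, isBorel_add_smul_one hb ht.1,
      isBorel_add_smul_one hc ht.2, fun i j => hz t (i, j)⟩
    simpa [MvPolynomial.aeval_eq_eval] using this)
  simpa [hz] using h

theorem map_schubertIdeal_le (hw : IsPartialPermutation w) :
    (schubertIdeal w).map (crossInclusion n) ≤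
      (schubertDAG w).hiddenIdeal (O := Observed n) Function.Embedding.inl := by
  have := Fintype.ofFinite (Ones w)
  rw [Ideal.map_le_iff_le_comap, schubertIdeal_eq_vanishingIdeal]
  intro g hg
  rw [Ideal.mem_comap, DAG.mem_hiddenIdeal_iff]
  intro θ
  obtain ⟨b, hb, hb'⟩ := exists_blockTriangular _ (onesCoord_injective hw false)
    (fun s i => (schubertDAG w).covariance θ (.inl (observed false i)) (.inr s))
    (fun s j => covariance_observed_hidden_eq_zero θ false s j)
  obtain ⟨c, hc, hc'⟩ := exists_blockTriangular _ (onesCoord_injective hw true)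
    (fun s j => (schubertDAG w).covariance (normalizeParam θ) (.inl (observed true j)) (.inr s))
    (fun s j => covariance_observed_hidden_eq_zero _ true s j)
  rw [crossInclusion, MvPolynomial.eval_rename, ← eval_eq_zero_of_blockTriangular hg hb hc]
  congr 2
  funext p
  rw [transpose_mul_mul_apply hw]
  refine (DAG.covariance_comm _ _ _ _).trans ((covariance_cross θ p.1 p.2).trans ?_)
  exact Finset.sum_congr rfl fun s _ =>
    congrArg₂ (· * ·) (congrFun (hb' s) p.1).symm (congrFun (hc' s) p.2).symm

theorem hiddenIdeal_le_map_schubertIdeal (hw : IsPartialPermutation w) :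
    (schubertDAG w).hiddenIdeal (O := Observed n) Function.Embedding.inl ≤
      (schubertIdeal w).map (crossInclusion n) := by
  classical
  intro f hf
  rw [DAG.mem_hiddenIdeal_iff] at hf
  have hinj : Function.Injective fun p : Fin n × Fin n =>
      (s(Sum.inl p.1, Sum.inr p.2) : Sym2 (Observed n)) := by
    rintro ⟨i, j⟩ ⟨i', j'⟩ h
    simpa [Sym2.eq_iff] using h
  rw [schubertIdeal_eq_vanishingIdeal]
  refine MvPolynomial.mem_map_vanishingIdeal hinj _ f fun z hz => ?_
  obtain ⟨b, c, hb, hc, hbc⟩ := hz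
  let u : Bool → Ones w → Fin n → ℂ := fun β s => if β then c s.1.2 else b s.1.1
  have hu : ∀ β s j, j < onesCoord β s → u β s j = 0 := by
    intro β s j hj
    cases β
    · exact hb.2 hj
    · exact hc.2 hj
  let A : ∀ (β : Bool) (j : Fin n), Matrix {k // k < j} {k // k < j} ℂ := fun β j =>
    Matrix.of fun k l => z s(observed β k.1, observed β l.1) - ∑ s, u β s k.1 * u β s l.1
  -- Only variances are shifted by `t`: cross entries stay fixed, and each matrix `A β j` becomes `A
  -- β j + t • 1`.
  let ζ : Sym2 (Observed n) → Polynomial ℂ := fun e =>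
    Polynomial.C (z e) + if e.IsDiag then Polynomial.X else 0
  have hζ : ∀ t e, (ζ e).eval t = z e + if e.IsDiag then t else 0 := by
    intro t e
    simp only [ζ]
    split_ifs <;> simp
  have hfin : (⋃ q : Bool × Fin n, {t : ℂ | (A q.1 q.2 + t • (1 : Matrix _ _ ℂ)).det = 0}).Finite :=
    Set.finite_iUnion fun q => Matrix.finite_setOf_det_add_smul_one_eq_zero _
  have h := MvPolynomial.eval_eq_zero_of_eventually f ζ _ hfin (by
    intro t ht
    simp only [Set.mem_iUnion, Set.mem_ofPred_eq, not_exists] at ht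
    obtain ⟨θ, hθ⟩ := exists_param u hu (fun e => (ζ e).eval t) (by
      intro i j
      have h1 := hbc i j
      rw [transpose_mul_mul_apply hw] at h1
      rw [hζ, if_neg (by simpa using observed_ne (by simp) i j), add_zero]
      exact h1) (by
      intro β j
      convert ht (β, j) using 2
      ext k l
      simp only [hζ, A, Matrix.of_apply, Matrix.add_apply, Matrix.smul_apply, Matrix.one_apply,
        Sym2.mk_isDiag_iff, (observed_injective β).eq_iff, Subtype.ext_iff, smul_eq_mul]
      split_ifs <;> ring)
    rw [← hf θ]
    congr 2
    funext e
    induction e using Sym2.ind with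
    | _ x y => exact (hθ x y).symm)
  simpa [hζ] using h

end Schubert

theorem mainTheorem7 (n : ℕ) (w : Matrix (Fin n) (Fin n) ℂ) (hw : IsPartialPermutation w) :
    (schubertIdeal w).map (crossInclusion n) =
      (schubertDAG w).hiddenIdeal (O := Observed n) Function.Embedding.inl :=
  le_antisymm (map_schubertIdeal_le hw) (hiddenIdeal_le_map_schubertIdeal hw)
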